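/- For real $z$ define $$\Lambda(z) := \lim_{n\to\infty}\left(\sum_{j=1}^{n}\frac{j}{j^{2}+z^{2}}-\ln n\right);$$ this limit exists for every real $z$, and $\Lambda(0)=\gamma$, where $\gamma$ is Euler's constant. Let $a>0$, $c=1-e^{-a}$ and $A=\ln(2\pi)+\gamma$. Then the integral and the series below converge absolutely, and $$\int_{0}^{1}e^{-at}\ln\Gamma(t)\,dt=\frac{A(a-c)}{a^{2}}-\frac{c}{2a}\,\Lambda\!\left(\frac{a}{2\pi}\right)+2c\sum_{j=1}^{\infty}\frac{\ln j}{a^{2}+4\pi^{2}j^{2}}.$$ -/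

import Mathlib

open Filter Topology

/-- The `n`-th approximant `∑_{j=1}^n j / (j² + z²) - ln n` of `Λ(z)`. -/
noncomputable def LambdaSeq (z : ℝ) (n : ℕ) : ℝ :=
  (∑ j ∈ Finset.Icc 1 n, (j : ℝ) / ((j : ℝ) ^ 2 + z ^ 2)) - Real.log n

/-- The function `Λ(z) = lim_{n → ∞} (∑_{j=1}^n j / (j² + z²) - ln n)`. -/
noncomputable def Lambda (z : ℝ) : ℝ :=
  limUnder atTop (LambdaSeq z)

/-! ### Laplace transform of the logarithm on the open right half-plane -/

section LaplaceLog

open MeasureTheory Set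

/-! The formula is Parseval's identity on `(0, 1]` for the pair `e^{-at}`, `ln Γ(t)`. The
coefficients of `e^{-at}` are `c / (a + 2πik)`; those of `ln Γ` are `(γ + log z) / z` at `z = 2πik ≠
0` (`integral_cexp_mul_log_Gamma`) and `ln(2π) / 2` at `k = 0` (Raabe).

For the nonzero coefficients, insert Euler's approximants `t ln n + ln n! - ∑_{m ≤ n} ln(t + m)`.
Since `e^{-zt}` has period `1`, the sum of logarithms becomes `∫_0^{n+1} e^{-zt} ln t dt`. Up to a
divergent boundary term, which the `t ln n` part cancels, this tends to the boundary value of the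
Laplace transform `-(γ + log z) / z` (`laplaceLog_eq`, `regularizedLaplaceLog_eq`).

In Parseval's sum the terms `±k` are paired. As `log(±2πij) = ln(2πj) ± iπ/2`, the real part yields
`∑ ln j / (a² + 4π²j²)` and a multiple of `∑ 1 / (a² + 4π²j²)`, itself known from Parseval for
`e^{-at}` alone (`hasSum_inv_sq_add_sq`); the imaginary part yields the series for `γ - Λ(a/2π)`
(`hasSum_Lambda`). -/

lemma abs_log_le_rpow {t : ℝ} (ht : 0 < t) {s : ℝ} (hs : 0 < s) :
    |Real.log t| ≤ s⁻¹ * (t ^ s + t ^ (-s)) := by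
  have h1 := Real.log_le_rpow_div ht.le hs
  have h2 := Real.log_le_rpow_div (inv_pos.2 ht).le hs
  rw [Real.log_inv, Real.inv_rpow ht.le, ← Real.rpow_neg ht.le] at h2
  have h3 := Real.rpow_pos_of_pos ht s
  have h4 := Real.rpow_pos_of_pos ht (-s)
  rw [abs_le, mul_add, inv_mul_eq_div, inv_mul_eq_div]
  constructor <;> linarith [div_pos h3 hs, div_pos h4 hs]

lemma integrableOn_rpow_mul_exp_neg {s b : ℝ} (hs : -1 < s) (hb : 0 < b) :
    IntegrableOn (fun t : ℝ => t ^ s * Real.exp (-b * t)) (Ioi 0) := by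
  simpa using integrableOn_rpow_mul_exp_neg_mul_rpow hs one_pos hb

lemma integrableOn_abs_log_mul_exp_neg {b : ℝ} (hb : 0 < b) :
    IntegrableOn (fun t : ℝ => |Real.log t| * Real.exp (-b * t)) (Ioi 0) := by
  have h : IntegrableOn (fun t : ℝ => (2⁻¹ : ℝ)⁻¹ * (t ^ (2⁻¹ : ℝ) * Real.exp (-b * t) +
      t ^ (-2⁻¹ : ℝ) * Real.exp (-b * t))) (Ioi 0) :=
    ((integrableOn_rpow_mul_exp_neg (by norm_num) hb).add
      (integrableOn_rpow_mul_exp_neg (by norm_num) hb)).const_mul _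
  refine h.mono' (by fun_prop) ?_
  filter_upwards [ae_restrict_mem measurableSet_Ioi] with t ht
  rw [Real.norm_of_nonneg (by positivity), ← add_mul, ← mul_assoc]
  gcongr
  exact abs_log_le_rpow ht (by norm_num)

lemma integrableOn_mul_abs_log_mul_exp_neg {b : ℝ} (hb : 0 < b) :
    IntegrableOn (fun t : ℝ => t * |Real.log t| * Real.exp (-b * t)) (Ioi 0) := by
  have h : IntegrableOn (fun t : ℝ => (2⁻¹ : ℝ)⁻¹ * (t ^ (1 + 2⁻¹ : ℝ) * Real.exp (-b * t) +
      t ^ (1 + -2⁻¹ : ℝ) * Real.exp (-b * t))) (Ioi 0) :=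
    ((integrableOn_rpow_mul_exp_neg (by norm_num) hb).add
      (integrableOn_rpow_mul_exp_neg (by norm_num) hb)).const_mul _
  refine h.mono' (by fun_prop) ?_
  filter_upwards [ae_restrict_mem measurableSet_Ioi] with t ht
  have ht0 : 0 < t := ht
  rw [Real.norm_of_nonneg (by positivity), ← add_mul, ← mul_assoc, Real.rpow_one_add' ht0.le (by norm_num),
    Real.rpow_one_add' ht0.le (by norm_num), ← mul_add, mul_left_comm]
  gcongr
  exact abs_log_le_rpow ht (by norm_num)

lemma norm_cexp_neg_mul_ofReal (z : ℂ) (t : ℝ) :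
    ‖Complex.exp (-z * t)‖ = Real.exp (-z.re * t) := by
  simp [Complex.norm_exp]

lemma integrableOn_cexp_neg_mul_log {z : ℂ} (hz : 0 < z.re) :
    IntegrableOn (fun t : ℝ => Complex.exp (-z * t) * (Real.log t : ℂ)) (Ioi 0) := by
  refine (integrableOn_abs_log_mul_exp_neg hz).mono' (by fun_prop) (ae_of_all _ fun t => ?_)
  rw [norm_mul, norm_cexp_neg_mul_ofReal, Complex.norm_real, Real.norm_eq_abs, mul_comm]

/-- The Laplace transform of the logarithm. -/
noncomputable def laplaceLog (z : ℂ) : ℂ :=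
  ∫ t in Ioi (0 : ℝ), Complex.exp (-z * t) * (Real.log t : ℂ)

lemma differentiableAt_laplaceLog {z : ℂ} (hz : 0 < z.re) :
    DifferentiableAt ℂ laplaceLog z := by
  have hs : {w : ℂ | z.re / 2 < w.re} ∈ 𝓝 z :=
    (isOpen_lt continuous_const Complex.continuous_re).mem_nhds (by simpa using hz)
  refine (hasDerivAt_integral_of_dominated_loc_of_deriv_le (μ := volume.restrict (Ioi (0 : ℝ)))
    (F := fun (w : ℂ) (t : ℝ) => Complex.exp (-w * t) * (Real.log t : ℂ))
    (F' := fun (w : ℂ) (t : ℝ) => Complex.exp (-w * t) * (-1 * t) * (Real.log t : ℂ))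
    (bound := fun t => t * |Real.log t| * Real.exp (-(z.re / 2) * t)) hs
    (Eventually.of_forall fun w => by fun_prop) (integrableOn_cexp_neg_mul_log hz)
    (by fun_prop) ?_ (integrableOn_mul_abs_log_mul_exp_neg (half_pos hz)) ?_).2.differentiableAt
  · filter_upwards [ae_restrict_mem measurableSet_Ioi] with t ht w hw
    have ht0 : 0 < t := ht
    have hw' : z.re / 2 < w.re := hw
    rw [norm_mul, norm_mul, norm_cexp_neg_mul_ofReal, Complex.norm_real, Real.norm_eq_abs,
      norm_mul, Complex.norm_real, Real.norm_of_nonneg ht0.le, norm_neg, norm_one, one_mul,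
      mul_assoc, mul_comm]
    gcongr
  · refine ae_of_all _ fun t w _ => ?_
    exact (((hasDerivAt_id w).neg.mul_const (t : ℂ)).cexp).mul_const _

/-- Both sides are `Γ'(1)`: one by differentiating Euler's integral, the other by its known value.
-/
lemma laplaceLog_one : laplaceLog 1 = -(Real.eulerMascheroniConstant : ℂ) := by
  have h1 := Complex.hasDerivAt_GammaIntegral (s := 1) (by simp)
  have h2 : Complex.GammaIntegral =ᶠ[𝓝 1] Complex.Gamma := by
    have : {w : ℂ | 0 < w.re} ∈ 𝓝 (1 : ℂ) :=
      (isOpen_lt continuous_const Complex.continuous_re).mem_nhds (by simp)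
    filter_upwards [this] with w hw
    exact (Complex.Gamma_eq_integral hw).symm
  have h3 := (Complex.hasDerivAt_Gamma_one.congr_of_eventuallyEq h2).unique h1
  rw [h3, laplaceLog]
  refine integral_congr_ae (ae_of_all _ fun t => ?_)
  simp [mul_comm]

lemma laplaceLog_ofReal {r : ℝ} (hr : 0 < r) :
    laplaceLog r = -(Real.eulerMascheroniConstant + Complex.log r) / r := by
  -- Substitute `u = rt`, with `ln t = ln u - ln r`, to reduce to the value at `1`.
  have h := integral_comp_mul_left_Ioi
    (fun u : ℝ => Complex.exp (-1 * u) * (Real.log u : ℂ) - Real.log r * Complex.exp (-1 * u)) 0 hr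
  have hexp : IntegrableOn (fun u : ℝ => Complex.exp (-1 * u)) (Ioi 0) :=
    integrableOn_exp_mul_complex_Ioi (by simp) 0
  rw [mul_zero, integral_sub (integrableOn_cexp_neg_mul_log (by simp)) (hexp.const_mul _),
    integral_const_mul, integral_exp_mul_complex_Ioi (by simp)] at h
  have h1 := laplaceLog_one
  rw [laplaceLog] at h1 ⊢
  rw [h1] at h
  have : ∫ t in Ioi (0 : ℝ), Complex.exp (-(r : ℂ) * t) * (Real.log t : ℂ) =
      ∫ x in Ioi (0 : ℝ), (Complex.exp (-1 * ((r * x : ℝ) : ℂ)) * (Real.log (r * x) : ℂ)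
        - Real.log r * Complex.exp (-1 * ((r * x : ℝ) : ℂ))) := by
    refine setIntegral_congr_fun measurableSet_Ioi fun t ht => ?_
    have ht0 : t ≠ 0 := ne_of_gt ht
    simp only [Real.log_mul hr.ne' ht0]
    push_cast
    ring_nf
  rw [this, h, ← Complex.ofReal_log hr.le, Complex.real_smul]
  push_cast
  simp
  ring

/-- Identity theorem: both sides are analytic on the half-plane and agree at the points `1 +
1/(n+1)`, which accumulate at `1`. -/
lemma laplaceLog_eq {z : ℂ} (hz : 0 < z.re) :
    laplaceLog z = -(Real.eulerMascheroniConstant + Complex.log z) / z := by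
  have hopen : IsOpen {w : ℂ | 0 < w.re} := isOpen_lt continuous_const Complex.continuous_re
  have hslit : ∀ w : ℂ, 0 < w.re → w ∈ Complex.slitPlane := fun w hw => Or.inl hw
  have hf : AnalyticOnNhd ℂ laplaceLog {w : ℂ | 0 < w.re} :=
    DifferentiableOn.analyticOnNhd
      (fun w hw => (differentiableAt_laplaceLog hw).differentiableWithinAt) hopen
  have hg : AnalyticOnNhd ℂ
      (fun w : ℂ => -(Real.eulerMascheroniConstant + Complex.log w) / w) {w : ℂ | 0 < w.re} := by
    refine DifferentiableOn.analyticOnNhd (fun w hw => ?_) hopen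
    have hw0 : w ≠ 0 := Complex.slitPlane_ne_zero (hslit w hw)
    exact ((((Complex.differentiableAt_log (hslit w hw)).const_add _).neg).div
      differentiableAt_id hw0).differentiableWithinAt
  refine hf.eqOn_of_preconnected_of_frequently_eq hg (convex_halfSpace_re_gt 0).isPreconnected
    (z₀ := 1) (by simp) ?_ hz
  have htend : Tendsto (fun n : ℕ => ((1 + ((n : ℝ) + 1)⁻¹ : ℝ) : ℂ)) atTop (𝓝[≠] 1) := by
    refine tendsto_nhdsWithin_iff.2 ⟨?_, Eventually.of_forall fun n => ?_⟩
    · have h0 : Tendsto (fun n : ℕ => 1 + ((n : ℝ) + 1)⁻¹) atTop (𝓝 (1 + 0)) := by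
        simpa using! (tendsto_one_div_add_atTop_nhds_zero_nat (𝕜 := ℝ)).const_add 1
      simpa [Function.comp_def] using (Complex.continuous_ofReal.tendsto _).comp h0
    · have : ((n : ℝ) + 1)⁻¹ ≠ 0 := by positivity
      intro h
      have h' : 1 + ((n : ℝ) + 1)⁻¹ = 1 := Complex.ofReal_injective (by rw [h, Complex.ofReal_one])
      exact this (by linarith)
  refine htend.frequently (Frequently.of_forall fun n => ?_)
  exact laplaceLog_ofReal (by positivity)

end LaplaceLog

/-! ### Extension of the transform to the imaginary axis -/

section BoundaryLaplaceLog

open MeasureTheory Set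

lemma intervalIntegrable_cexp_mul_log (z : ℂ) (a b : ℝ) :
    IntervalIntegrable (fun t : ℝ => Complex.exp (-z * t) * (Real.log t : ℂ)) volume a b :=
  IntervalIntegrable.continuousOn_mul
    (⟨Integrable.ofReal intervalIntegral.intervalIntegrable_log'.1,
      Integrable.ofReal intervalIntegral.intervalIntegrable_log'.2⟩) (by fun_prop)

lemma intervalIntegrable_cexp_div_sq (z : ℂ) {b : ℝ} (hb : 1 ≤ b) :
    IntervalIntegrable (fun t : ℝ => Complex.exp (-z * t) / (t : ℂ) ^ 2) volume 1 b := by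
  refine ContinuousOn.intervalIntegrable fun t ht => ?_
  rw [uIcc_of_le hb] at ht
  have : (t : ℂ) ^ 2 ≠ 0 := pow_ne_zero 2 (Complex.ofReal_ne_zero.2 (by linarith [ht.1]))
  exact (ContinuousAt.div (f := fun t : ℝ => Complex.exp (-z * t)) (g := fun t : ℝ => (t : ℂ) ^ 2)
    (by fun_prop) (by fun_prop) this).continuousWithinAt

/-- Two integrations by parts leave an integral with weight `1/t²`, absolutely convergent at
infinity even for `Re z = 0`. -/
lemma integral_one_cexp_mul_log {z : ℂ} (hz : z ≠ 0) {b : ℝ} (hb : 1 ≤ b) :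
    ∫ t in (1 : ℝ)..b, Complex.exp (-z * t) * (Real.log t : ℂ) =
      -(Complex.exp (-z * b) * (Real.log b / z + 1 / (z ^ 2 * b))) + Complex.exp (-z) / z ^ 2
        - (∫ t in (1 : ℝ)..b, Complex.exp (-z * t) / (t : ℂ) ^ 2) / z ^ 2 := by
  have h := intervalIntegral.integral_eq_sub_of_hasDerivAt (a := 1) (b := b)
    (f := fun t : ℝ => -(Complex.exp (-z * t) * (Real.log t / z + 1 / (z ^ 2 * t))))
    (f' := fun t : ℝ => Complex.exp (-z * t) * (Real.log t : ℂ)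
      + Complex.exp (-z * t) / (t : ℂ) ^ 2 / z ^ 2) ?_
    ((intervalIntegrable_cexp_mul_log z 1 b).add
      ((intervalIntegrable_cexp_div_sq z hb).div_const _))
  · rw [intervalIntegral.integral_add (intervalIntegrable_cexp_mul_log z 1 b)
      ((intervalIntegrable_cexp_div_sq z hb).div_const _), intervalIntegral.integral_div] at h
    rw [eq_sub_iff_add_eq, h]
    simp
    ring
  · intro t ht
    rw [uIcc_of_le hb] at ht
    have ht0 : t ≠ 0 := by linarith [ht.1]
    have ht1 : (t : ℂ) ≠ 0 := Complex.ofReal_ne_zero.2 ht0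
    have h1 : HasDerivAt (fun t : ℝ => Complex.exp (-z * t)) (Complex.exp (-z * t) * (-z * 1)) t :=
      (((hasDerivAt_id (t : ℂ)).const_mul (-z)).cexp).comp_ofReal
    have h2 : HasDerivAt (fun t : ℝ => (Real.log t : ℂ)) ((t⁻¹ : ℝ) : ℂ) t :=
      (Real.hasDerivAt_log ht0).ofReal_comp
    have h3 : HasDerivAt (fun t : ℝ => (1 : ℂ) / (z ^ 2 * t)) (-(z ^ 2 * 1) / (z ^ 2 * t) ^ 2) t := by
      simp_rw [one_div]
      exact (((hasDerivAt_id (t : ℂ)).const_mul (z ^ 2)).inv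
        (mul_ne_zero (pow_ne_zero 2 hz) ht1)).comp_ofReal
    refine ((h1.mul ((h2.div_const z).add h3)).neg).congr_deriv ?_
    simp only [Complex.ofReal_inv, Pi.add_apply]
    field_simp
    ring

lemma norm_cexp_div_sq_le {z : ℂ} (hz : 0 ≤ z.re) {t : ℝ} (ht : 0 < t) :
    ‖Complex.exp (-z * t) / (t : ℂ) ^ 2‖ ≤ t ^ (-2 : ℝ) := by
  rw [norm_div, norm_cexp_neg_mul_ofReal, norm_pow, Complex.norm_real, Real.norm_of_nonneg ht.le,
    Real.rpow_neg ht.le, Real.rpow_two, div_eq_mul_inv]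
  refine mul_le_of_le_one_left (by positivity) (Real.exp_le_one_iff.2 ?_)
  nlinarith

lemma integrableOn_cexp_div_sq {z : ℂ} (hz : 0 ≤ z.re) :
    IntegrableOn (fun t : ℝ => Complex.exp (-z * t) / (t : ℂ) ^ 2) (Ioi 1) := by
  refine (integrableOn_Ioi_rpow_of_lt (a := -2) (by norm_num) one_pos).mono'
    (Measurable.aestronglyMeasurable (by fun_prop)) ?_
  filter_upwards [ae_restrict_mem measurableSet_Ioi] with t ht
  exact norm_cexp_div_sq_le hz (one_pos.trans ht)

/-- The constant term of `∫_0^b e^{-zt} ln t dt` as `b → ∞`, for `Re z ≥ 0` and `z ≠ 0`. -/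
noncomputable def regularizedLaplaceLog (z : ℂ) : ℂ :=
  (∫ t in (0 : ℝ)..1, Complex.exp (-z * t) * (Real.log t : ℂ)) + Complex.exp (-z) / z ^ 2
    - (∫ t in Ioi (1 : ℝ), Complex.exp (-z * t) / (t : ℂ) ^ 2) / z ^ 2

lemma tendsto_integral_cexp_mul_log_add {z : ℂ} (hz : 0 ≤ z.re) (hz0 : z ≠ 0) :
    Tendsto (fun b : ℝ => (∫ t in (0 : ℝ)..b, Complex.exp (-z * t) * (Real.log t : ℂ))
      + Complex.exp (-z * b) * (Real.log b / z)) atTop (𝓝 (regularizedLaplaceLog z)) := by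
  have hsmall : Tendsto (fun b : ℝ => Complex.exp (-z * b) * (1 / (z ^ 2 * b))) atTop (𝓝 0) := by
    refine squeeze_zero_norm' (a := fun b : ℝ => ‖z ^ 2‖⁻¹ * b⁻¹) ?_
      (by simpa only [mul_zero] using tendsto_inv_atTop_zero.const_mul (‖z ^ 2‖⁻¹))
    filter_upwards [eventually_gt_atTop 0] with b hb
    rw [norm_mul, norm_cexp_neg_mul_ofReal, one_div, norm_inv, norm_mul, Complex.norm_real,
      Real.norm_of_nonneg hb.le, mul_inv]
    refine mul_le_of_le_one_left (by positivity) (Real.exp_le_one_iff.2 ?_)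
    nlinarith
  have hint := intervalIntegral_tendsto_integral_Ioi 1 (integrableOn_cexp_div_sq hz) tendsto_id
  have hlim := ((tendsto_const_nhds (x := (∫ t in (0 : ℝ)..1, Complex.exp (-z * t) *
    (Real.log t : ℂ)) + Complex.exp (-z) / z ^ 2)).sub (hint.div_const (z ^ 2))).sub hsmall
  rw [sub_zero] at hlim
  refine hlim.congr' ?_
  filter_upwards [eventually_ge_atTop 1] with b hb
  rw [← intervalIntegral.integral_add_adjacent_intervals (intervalIntegrable_cexp_mul_log z 0 1)
    (intervalIntegrable_cexp_mul_log z 1 b), integral_one_cexp_mul_log hz0 hb]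
  simp only [id]
  ring

lemma regularizedLaplaceLog_eq_laplaceLog {z : ℂ} (hz : 0 < z.re) :
    regularizedLaplaceLog z = laplaceLog z := by
  have hz0 : z ≠ 0 := fun h => by simp [h] at hz
  have h1 := intervalIntegral_tendsto_integral_Ioi 0 (integrableOn_cexp_neg_mul_log hz) tendsto_id
  have h2 : Tendsto (fun b : ℝ => Complex.exp (-z * b) * (Real.log b / z)) atTop (𝓝 0) := by
    refine squeeze_zero_norm' (a := fun b : ℝ => b ^ (1 : ℝ) * Real.exp (-z.re * b) * ‖z‖⁻¹) ?_
      (by simpa using (tendsto_rpow_mul_exp_neg_mul_atTop_nhds_zero 1 z.re hz).mul_const ‖z‖⁻¹)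
    filter_upwards [eventually_ge_atTop 1] with b hb
    rw [norm_mul, norm_cexp_neg_mul_ofReal, norm_div, Complex.norm_real,
      Real.norm_of_nonneg (Real.log_nonneg hb), Real.rpow_one, mul_comm b, mul_assoc,
      div_eq_mul_inv]
    gcongr
    exact Real.log_le_self (by linarith)
  have h3 := h1.add h2
  rw [add_zero] at h3
  exact tendsto_nhds_unique (tendsto_integral_cexp_mul_log_add hz.le hz0) h3

/-- Let `e → 0+` in the identity at `z + e`, which lies in the open half-plane; `|ln t|` and `t⁻²`
dominate uniformly in `e`. -/
lemma regularizedLaplaceLog_eq {z : ℂ} (hz : 0 ≤ z.re) (hz0 : z ∈ Complex.slitPlane) :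
    regularizedLaplaceLog z = -(Real.eulerMascheroniConstant + Complex.log z) / z := by
  have hne : z ≠ 0 := Complex.slitPlane_ne_zero hz0
  have happ : Tendsto (fun e : ℝ => z + e) (𝓝[>] 0) (𝓝 z) := by
    have : ContinuousAt (fun e : ℝ => z + e) 0 := by fun_prop
    simpa [ContinuousAt] using this.tendsto.mono_left (nhdsWithin_le_nhds (s := Ioi 0))
  have hpos : ∀ᶠ e : ℝ in 𝓝[>] 0, 0 < (z + e).re := by
    filter_upwards [self_mem_nhdsWithin] with e he
    have he0 : (0 : ℝ) < e := he
    simp only [Complex.add_re, Complex.ofReal_re]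
    linarith
  have hlog : Tendsto (fun e : ℝ => -(Real.eulerMascheroniConstant + Complex.log (z + e)) / (z + e))
      (𝓝[>] 0) (𝓝 (-(Real.eulerMascheroniConstant + Complex.log z) / z)) :=
    ((happ.clog hz0).const_add _).neg.div happ hne
  have hE : Tendsto (fun e : ℝ => ∫ t in (0 : ℝ)..1, Complex.exp (-(z + e) * t) * (Real.log t : ℂ))
      (𝓝[>] 0) (𝓝 (∫ t in (0 : ℝ)..1, Complex.exp (-z * t) * (Real.log t : ℂ))) := by
    refine intervalIntegral.tendsto_integral_filter_of_dominated_convergence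
      (fun t => |Real.log t|) (Eventually.of_forall fun e => by fun_prop) ?_
      intervalIntegral.intervalIntegrable_log'.abs ?_
    · filter_upwards [hpos] with e he
      refine ae_of_all _ fun t ht => ?_
      rw [uIoc_of_le zero_le_one] at ht
      rw [norm_mul, norm_cexp_neg_mul_ofReal, Complex.norm_real, Real.norm_eq_abs]
      refine mul_le_of_le_one_left (abs_nonneg _) (Real.exp_le_one_iff.2 ?_)
      nlinarith [ht.1]
    · exact ae_of_all _ fun t _ => ((happ.neg.mul_const _).cexp).mul_const _
  have hP : Tendsto (fun e : ℝ => ∫ t in Ioi (1 : ℝ), Complex.exp (-(z + e) * t) / (t : ℂ) ^ 2)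
      (𝓝[>] 0) (𝓝 (∫ t in Ioi (1 : ℝ), Complex.exp (-z * t) / (t : ℂ) ^ 2)) := by
    refine tendsto_integral_filter_of_dominated_convergence
      (fun t => t ^ (-2 : ℝ))
      (Eventually.of_forall fun e => Measurable.aestronglyMeasurable (by fun_prop)) ?_
      (integrableOn_Ioi_rpow_of_lt (by norm_num) one_pos) ?_
    · filter_upwards [hpos] with e he
      filter_upwards [ae_restrict_mem measurableSet_Ioi] with t ht
      exact norm_cexp_div_sq_le he.le (one_pos.trans ht)
    · exact ae_of_all _ fun t => ((happ.neg.mul_const _).cexp).div_const _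
  have hreg : Tendsto (fun e : ℝ => regularizedLaplaceLog (z + e)) (𝓝[>] 0)
      (𝓝 (regularizedLaplaceLog z)) :=
    (hE.add (happ.neg.cexp.div (happ.pow 2) (pow_ne_zero 2 hne))).sub
      (hP.div (happ.pow 2) (pow_ne_zero 2 hne))
  refine tendsto_nhds_unique hreg (hlog.congr' ?_)
  filter_upwards [hpos] with e he
  rw [regularizedLaplaceLog_eq_laplaceLog he, laplaceLog_eq he]

end BoundaryLaplaceLog

/-! ### Fourier coefficients of `ln Γ` -/

section FourierLogGamma

open MeasureTheory Set Real.BohrMollerup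

lemma log_Gamma_add_one {y : ℝ} (hy : 0 < y) :
    Real.log (Real.Gamma (y + 1)) = Real.log (Real.Gamma y) + Real.log y := by
  rw [Real.Gamma_add_one hy.ne', Real.log_mul hy.ne' (Real.Gamma_pos_of_pos hy).ne', add_comm]

lemma logGammaSeq_le_log_Gamma {t : ℝ} (ht : 0 < t) {n : ℕ} (hn : n ≠ 0) :
    logGammaSeq t n ≤ Real.log (Real.Gamma t) := by
  simpa using ge_logGammaSeq Real.convexOn_log_Gamma log_Gamma_add_one ht hn

lemma log_Gamma_le_logGammaSeq_add {t : ℝ} (ht : t ∈ Ioc (0 : ℝ) 1) (n : ℕ) :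
    Real.log (Real.Gamma t) ≤ logGammaSeq t n + (Real.log (n + 1) - Real.log n) := by
  have h := le_logGammaSeq Real.convexOn_log_Gamma log_Gamma_add_one ht.1 ht.2 n
  have hlog : Real.log n ≤ Real.log (n + 1) := by
    rcases n.eq_zero_or_pos with rfl | hn
    · simp
    · exact Real.log_le_log (by exact_mod_cast hn) (by linarith)
  simp only [Function.comp, Real.Gamma_one, Real.log_one] at h
  nlinarith [ht.2]

/-- Log-convexity squeezes `ln Γ` as in Bohr–Mollerup. The bound is free of `t`, so limits pass
through the integral. -/
lemma abs_log_Gamma_sub_logGammaSeq_le {t : ℝ} (ht : t ∈ Ioc (0 : ℝ) 1) {n : ℕ} (hn : n ≠ 0) :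
    |Real.log (Real.Gamma t) - logGammaSeq t n| ≤ Real.log (n + 1) - Real.log n := by
  rw [abs_of_nonneg (sub_nonneg.2 (logGammaSeq_le_log_Gamma ht.1 hn))]
  linarith [log_Gamma_le_logGammaSeq_add ht n]

lemma abs_log_Gamma_le {t : ℝ} (ht : t ∈ Ioc (0 : ℝ) 1) :
    |Real.log (Real.Gamma t)| ≤ 2 * Real.log 2 + |Real.log t| := by
  have h := abs_log_Gamma_sub_logGammaSeq_le ht one_ne_zero
  have h1 : logGammaSeq t 1 = -Real.log t - Real.log (t + 1) := by
    simp [logGammaSeq, Finset.sum_range_succ]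
    ring
  have h2 : 0 ≤ Real.log (t + 1) := Real.log_nonneg (by linarith [ht.1])
  have h3 : Real.log (t + 1) ≤ Real.log 2 := Real.log_le_log (by linarith [ht.1]) (by linarith [ht.2])
  rw [h1] at h
  norm_num at h
  have h4 := neg_abs_le (Real.log t)
  have h5 := le_abs_self (Real.log t)
  rw [abs_le] at h ⊢
  constructor <;> linarith [h.1, h.2]

lemma aestronglyMeasurable_log_Gamma :
    AEStronglyMeasurable (fun t : ℝ => Real.log (Real.Gamma t)) (volume.restrict (Ioc 0 1)) := by
  refine ContinuousOn.aestronglyMeasurable (fun t ht => ?_) measurableSet_Ioc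
  have hd : DifferentiableAt ℝ Real.Gamma t := Real.differentiableAt_Gamma fun m hm => by
    have : (0 : ℝ) ≤ m := m.cast_nonneg
    linarith [ht.1]
  exact (hd.continuousAt.log (Real.Gamma_pos_of_pos ht.1).ne').continuousWithinAt

lemma memLp_log_unitInterval : MemLp Real.log 2 (volume.restrict (Ioc 0 1)) := by
  rw [memLp_two_iff_integrable_sq (by fun_prop)]
  have h : IntegrableOn (fun t : ℝ => 64 * t ^ (-(1 / 2) : ℝ)) (Ioc 0 1) :=
    ((intervalIntegrable_iff_integrableOn_Ioc_of_le zero_le_one).1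
      (intervalIntegral.intervalIntegrable_rpow' (by norm_num))).const_mul _
  refine h.mono' (by fun_prop) ?_
  filter_upwards [ae_restrict_mem measurableSet_Ioc] with t ht
  -- Exponent `1/4`, so that the square is at most `64 t^{-1/2}`, still integrable at `0`.
  have h1 := abs_log_le_rpow ht.1 (s := 4⁻¹) (by norm_num)
  have h2 : t ^ (4⁻¹ : ℝ) ≤ t ^ (-4⁻¹ : ℝ) :=
    Real.rpow_le_rpow_of_exponent_ge ht.1 ht.2 (by norm_num)
  have h3 : |Real.log t| ≤ 8 * t ^ (-4⁻¹ : ℝ) := by linarith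
  have h4 : t ^ (-(1 / 2) : ℝ) = (t ^ (-4⁻¹ : ℝ)) ^ 2 := by
    rw [← Real.rpow_natCast, ← Real.rpow_mul ht.1.le]
    norm_num
  rw [Real.norm_of_nonneg (sq_nonneg _), ← sq_abs, h4]
  calc |Real.log t| ^ 2 ≤ (8 * t ^ (-4⁻¹ : ℝ)) ^ 2 := by gcongr
    _ = _ := by ring

lemma memLp_log_Gamma :
    MemLp (fun t : ℝ => Real.log (Real.Gamma t)) 2 (volume.restrict (Ioc 0 1)) := by
  have h : MemLp (fun t : ℝ => 2 * Real.log 2 + ‖Real.log t‖) 2 (volume.restrict (Ioc 0 1)) :=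
    (memLp_const (2 * Real.log 2)).add memLp_log_unitInterval.norm
  refine h.mono' aestronglyMeasurable_log_Gamma ?_
  filter_upwards [ae_restrict_mem measurableSet_Ioc] with t ht
  exact abs_log_Gamma_le ht

lemma intervalIntegrable_log_Gamma :
    IntervalIntegrable (fun t : ℝ => Real.log (Real.Gamma t)) volume 0 1 :=
  (intervalIntegrable_iff_integrableOn_Ioc_of_le zero_le_one).2
    (memLp_log_Gamma.integrable one_le_two)

lemma intervalIntegrable_log_add (z : ℂ) (m : ℝ) :
    IntervalIntegrable (fun t : ℝ => Complex.exp (-z * t) * (Real.log (t + m) : ℂ)) volume 0 1 := by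
  have h : IntervalIntegrable (fun t : ℝ => Real.log (t + m)) volume 0 1 := by
    simpa using (intervalIntegral.intervalIntegrable_log' (a := 0 + m) (b := 1 + m)).comp_add_right m
  exact IntervalIntegrable.continuousOn_mul ⟨Integrable.ofReal h.1, Integrable.ofReal h.2⟩
    (by fun_prop)

lemma sum_integral_cexp_mul_log_add {z : ℂ} (hz : Complex.exp z = 1) (n : ℕ) :
    ∑ m ∈ Finset.range n, ∫ t in (0 : ℝ)..1, Complex.exp (-z * t) * (Real.log (t + m) : ℂ) =
      ∫ t in (0 : ℝ)..n, Complex.exp (-z * t) * (Real.log t : ℂ) := by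
  have h := intervalIntegral.sum_integral_adjacent_intervals (a := fun k : ℕ => (k : ℝ)) (n := n)
    (fun k _ => intervalIntegrable_cexp_mul_log z k (k + 1 : ℕ))
  rw [Nat.cast_zero] at h
  rw [← h]
  refine Finset.sum_congr rfl fun m _ => ?_
  have h2 := intervalIntegral.integral_comp_add_right (a := 0) (b := 1)
    (fun t : ℝ => Complex.exp (-z * t) * (Real.log t : ℂ)) (m : ℝ)
  rw [zero_add, add_comm (1 : ℝ)] at h2
  push_cast
  rw [← h2]
  refine intervalIntegral.integral_congr fun t _ => ?_
  have : Complex.exp (-z * ((t + m : ℝ) : ℂ)) = Complex.exp (-z * t) := by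
    have hm : Complex.exp (m * -z) = 1 := by rw [Complex.exp_nat_mul, Complex.exp_neg, hz]; simp
    push_cast
    rw [mul_add, Complex.exp_add, mul_comm (-z) (m : ℂ), hm, mul_one]
  simp only [this]

/-- The case `z = 0` is allowed: it serves Raabe's formula. -/
lemma integral_cexp_mul_logGammaSeq {z : ℂ} (hz : Complex.exp z = 1) (n : ℕ) :
    IntervalIntegrable (fun t : ℝ => Complex.exp (-z * t) * (logGammaSeq t n : ℂ)) volume 0 1 ∧
    ∫ t in (0 : ℝ)..1, Complex.exp (-z * t) * (logGammaSeq t n : ℂ) =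
      Real.log n * (∫ t in (0 : ℝ)..1, t * Complex.exp (-z * t)) +
      Real.log n.factorial * (∫ t in (0 : ℝ)..1, Complex.exp (-z * t)) -
      ∫ t in (0 : ℝ)..(n + 1), Complex.exp (-z * t) * (Real.log t : ℂ) := by
  have heq : (fun t : ℝ => Complex.exp (-z * t) * (logGammaSeq t n : ℂ)) = fun t : ℝ =>
      (Real.log n * (t * Complex.exp (-z * t)) + Real.log n.factorial * Complex.exp (-z * t)) -
        ∑ m ∈ Finset.range (n + 1), Complex.exp (-z * t) * (Real.log (t + m) : ℂ) := by
    funext t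
    rw [logGammaSeq, ← Finset.mul_sum]
    push_cast
    ring
  have i1 : IntervalIntegrable (fun t : ℝ => Real.log n * (t * Complex.exp (-z * t))) volume 0 1 :=
    Continuous.intervalIntegrable (by fun_prop) _ _
  have i2 : IntervalIntegrable (fun t : ℝ => Real.log n.factorial * Complex.exp (-z * t))
      volume 0 1 := Continuous.intervalIntegrable (by fun_prop) _ _
  have i3 : IntervalIntegrable (fun t : ℝ => ∑ m ∈ Finset.range (n + 1),
      Complex.exp (-z * t) * (Real.log (t + m) : ℂ)) volume 0 1 := by
    simpa only [Finset.sum_fn] using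
      IntervalIntegrable.sum (Finset.range (n + 1)) (fun m _ => intervalIntegrable_log_add z m)
  have hs := sum_integral_cexp_mul_log_add hz (n + 1)
  push_cast at hs
  rw [heq]
  refine ⟨(i1.add i2).sub i3, ?_⟩
  rw [intervalIntegral.integral_sub (i1.add i2) i3, intervalIntegral.integral_add i1 i2,
    intervalIntegral.integral_const_mul, intervalIntegral.integral_const_mul,
    intervalIntegral.integral_finsetSum
      (f := fun (m : ℕ) (t : ℝ) => Complex.exp (-z * t) * (Real.log (t + m) : ℂ))
      (fun m _ => intervalIntegrable_log_add z m), hs]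

lemma intervalIntegrable_cexp_mul_log_Gamma (z : ℂ) :
    IntervalIntegrable (fun t : ℝ => Complex.exp (-z * t) * (Real.log (Real.Gamma t) : ℂ))
      volume 0 1 :=
  IntervalIntegrable.continuousOn_mul ⟨Integrable.ofReal intervalIntegrable_log_Gamma.1,
    Integrable.ofReal intervalIntegrable_log_Gamma.2⟩ (by fun_prop)

lemma re_eq_zero_of_cexp_eq_one {z : ℂ} (hz : Complex.exp z = 1) : z.re = 0 := by
  have h : Real.exp z.re = 1 := by rw [← Complex.norm_exp, hz, norm_one]
  simpa using h

lemma tendsto_integral_cexp_mul_logGammaSeq {z : ℂ} (hz : Complex.exp z = 1) :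
    Tendsto (fun n : ℕ => ∫ t in (0 : ℝ)..1, Complex.exp (-z * t) * (logGammaSeq t n : ℂ)) atTop
      (𝓝 (∫ t in (0 : ℝ)..1, Complex.exp (-z * t) * (Real.log (Real.Gamma t) : ℂ))) := by
  rw [tendsto_iff_norm_sub_tendsto_zero]
  refine squeeze_zero' (Eventually.of_forall fun n => norm_nonneg _) ?_
    Real.tendsto_log_nat_add_one_sub_log
  filter_upwards [eventually_ne_atTop 0] with n hn
  rw [← intervalIntegral.integral_sub (integral_cexp_mul_logGammaSeq hz n).1
    (intervalIntegrable_cexp_mul_log_Gamma z)]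
  refine (intervalIntegral.norm_integral_le_of_norm_le_const
    (C := Real.log (n + 1) - Real.log n) fun t ht => ?_).trans (by simp)
  rw [uIoc_of_le zero_le_one] at ht
  rw [← mul_sub, norm_mul, norm_cexp_neg_mul_ofReal, re_eq_zero_of_cexp_eq_one hz,
    ← Complex.ofReal_sub, Complex.norm_real, Real.norm_eq_abs, abs_sub_comm]
  simpa using abs_log_Gamma_sub_logGammaSeq_le ht hn

lemma integral_cexp_of_cexp_eq_one {z : ℂ} (hz : Complex.exp z = 1) (hz0 : z ≠ 0) :
    ∫ t in (0 : ℝ)..1, Complex.exp (-z * t) = 0 := by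
  rw [integral_exp_mul_complex (neg_ne_zero.2 hz0)]
  simp [Complex.exp_neg, hz]

lemma integral_mul_cexp_of_cexp_eq_one {z : ℂ} (hz : Complex.exp z = 1) (hz0 : z ≠ 0) :
    ∫ t in (0 : ℝ)..1, t * Complex.exp (-z * t) = -1 / z := by
  have h := intervalIntegral.integral_eq_sub_of_hasDerivAt (a := 0) (b := 1)
    (f := fun t : ℝ => -(t / z + 1 / z ^ 2) * Complex.exp (-z * t))
    (f' := fun t : ℝ => t * Complex.exp (-z * t)) ?_
    (Continuous.intervalIntegrable (by fun_prop) _ _)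
  · rw [h]
    simp [Complex.exp_neg, hz]
    ring
  · intro t _
    have h1 : HasDerivAt (fun t : ℝ => Complex.exp (-z * t)) (Complex.exp (-z * t) * (-z * 1)) t :=
      (((hasDerivAt_id (t : ℂ)).const_mul (-z)).cexp).comp_ofReal
    have h2 : HasDerivAt (fun t : ℝ => -((t : ℂ) / z + 1 / z ^ 2)) (-(1 / z)) t :=
      ((((hasDerivAt_id (t : ℂ)).div_const z).add_const (1 / z ^ 2)).neg).comp_ofReal
    refine (h2.mul h1).congr_deriv ?_
    field_simp
    ring

/-- The nonconstant Fourier coefficients of `ln Γ` on `(0, 1)`. -/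
lemma integral_cexp_mul_log_Gamma {z : ℂ} (hz : Complex.exp z = 1) (hz0 : z ∈ Complex.slitPlane) :
    ∫ t in (0 : ℝ)..1, Complex.exp (-z * t) * (Real.log (Real.Gamma t) : ℂ) =
      (Real.eulerMascheroniConstant + Complex.log z) / z := by
  have hne := Complex.slitPlane_ne_zero hz0
  have hre := re_eq_zero_of_cexp_eq_one hz
  have h1 : Tendsto (fun n : ℕ => (n : ℝ) + 1) atTop atTop :=
    tendsto_atTop_add_const_right _ _ tendsto_natCast_atTop_atTop
  have h2 := (tendsto_integral_cexp_mul_log_add hre.ge hne).comp h1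
  have h3 := (Complex.continuous_ofReal.tendsto _).comp Real.tendsto_log_nat_add_one_sub_log
  -- The approximant contributes `-ln n / z` and the boundary term is `ln(n+1) / z`; they differ by
  -- `(ln(n+1) - ln n) / z → 0`.
  have h4 := (h3.div_const z).sub h2
  rw [regularizedLaplaceLog_eq hre.ge hz0, Complex.ofReal_zero, zero_div, zero_sub, neg_div,
    neg_neg] at h4
  refine tendsto_nhds_unique (tendsto_integral_cexp_mul_logGammaSeq hz) (h4.congr fun n => ?_)
  have hexp : Complex.exp (-z * ((n + 1 : ℝ) : ℂ)) = 1 := by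
    have : -z * ((n + 1 : ℝ) : ℂ) = (n + 1 : ℕ) * -z := by push_cast; ring
    rw [this, Complex.exp_nat_mul, Complex.exp_neg, hz]
    simp
  rw [(integral_cexp_mul_logGammaSeq hz n).2, integral_cexp_of_cexp_eq_one hz hne,
    integral_mul_cexp_of_cexp_eq_one hz hne]
  simp only [Function.comp, hexp]
  push_cast
  ring

/-- Raabe's formula on `(0, 1)`. -/
lemma integral_log_Gamma_unitInterval :
    ∫ t in (0 : ℝ)..1, Real.log (Real.Gamma t) = Real.log (2 * Real.pi) / 2 := by
  have h := tendsto_integral_cexp_mul_logGammaSeq (z := 0) (by simp)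
  simp only [neg_zero, zero_mul, Complex.exp_zero, one_mul, intervalIntegral.integral_ofReal] at h
  have h0 : Tendsto (fun n : ℕ => ∫ t in (0 : ℝ)..1, logGammaSeq t n) atTop
      (𝓝 (∫ t in (0 : ℝ)..1, Real.log (Real.Gamma t))) := by
    simpa [Function.comp_def] using (Complex.continuous_re.tendsto _).comp h
  have hst : Tendsto (fun n => Real.log (Stirling.stirlingSeq n)) atTop
      (𝓝 (Real.log (Real.sqrt Real.pi))) :=
    Stirling.tendsto_stirlingSeq_sqrt_pi.log (by positivity)
  -- After Stirling's formula replaces `ln n!`, this is the only other nonconstant part of the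
  -- integrated approximant.
  have hlog : Tendsto (fun n : ℕ => ((n : ℝ) + 1) * (Real.log (n + 1) - Real.log n)) atTop
      (𝓝 1) := by
    have h1 := (Real.tendsto_mul_log_one_add_div_atTop 1).comp tendsto_natCast_atTop_atTop
    have h2 := h1.add Real.tendsto_log_nat_add_one_sub_log
    rw [add_zero] at h2
    refine h2.congr' ?_
    filter_upwards [eventually_ne_atTop 0] with n hn
    have hn0 : (n : ℝ) ≠ 0 := Nat.cast_ne_zero.2 hn
    have h3 : 1 + 1 / (n : ℝ) = ((n : ℝ) + 1) / n := by field_simp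
    rw [Function.comp_apply, h3, Real.log_div (by positivity) hn0]
    ring
  have hlim := (hst.sub hlog).add_const (Real.log 2 / 2 + 1)
  have hval : Real.log (Real.sqrt Real.pi) - 1 + (Real.log 2 / 2 + 1) =
      Real.log (2 * Real.pi) / 2 := by
    rw [Real.log_sqrt Real.pi_pos.le, Real.log_mul two_ne_zero Real.pi_ne_zero]
    ring
  rw [hval] at hlim
  refine tendsto_nhds_unique h0 (hlim.congr' ?_)
  filter_upwards [eventually_ne_atTop 0] with n hn
  have hn0 : (n : ℝ) ≠ 0 := Nat.cast_ne_zero.2 hn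
  have hI := (integral_cexp_mul_logGammaSeq (z := 0) (by simp) n).2
  have hid : ∫ t in (0 : ℝ)..1, (t : ℂ) = 1 / 2 := by
    rw [intervalIntegral.integral_ofReal, integral_id]
    norm_num
  simp only [neg_zero, zero_mul, Complex.exp_zero, one_mul, mul_one, hid,
    intervalIntegral.integral_ofReal, integral_log_from_zero, intervalIntegral.integral_const] at hI
  have hI' : ∫ t in (0 : ℝ)..1, logGammaSeq t n = Real.log n * (1 / 2) + Real.log n.factorial
      - ((n + 1) * Real.log (n + 1) - (n + 1)) := by
    apply Complex.ofReal_injective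
    rw [hI]
    push_cast
    simp
  rw [hI', Stirling.log_stirlingSeq_formula, Real.log_mul two_ne_zero hn0,
    Real.log_div hn0 (Real.exp_ne_zero 1), Real.log_exp]
  ring

end FourierLogGamma

/-! ### Parseval's identity and its two applications -/

section Parseval

open MeasureTheory Set ComplexConjugate

/-- Parseval's identity for inner products on `(0, 1]`. -/
lemma hasSum_conj_fourierCoeffOn_mul {f g : ℝ → ℂ}
    (hf : MemLp f 2 (volume.restrict (Ioc 0 1))) (hg : MemLp g 2 (volume.restrict (Ioc 0 1))) :
    HasSum (fun k : ℤ => conj (fourierCoeffOn zero_lt_one f k) * fourierCoeffOn zero_lt_one g k)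
      (∫ t in (0 : ℝ)..1, conj (f t) * g t) := by
  have hfact : Fact ((0 : ℝ) < 1 - 0) := ⟨by norm_num⟩
  -- The endpoint `1` becomes `0 + (1 - 0)`, the form matching a circle of period `1 - 0`.
  rw [← add_sub_cancel (0 : ℝ) 1] at hf hg
  have hF := hf.memLp_liftIoc.haarAddCircle
  have hG := hg.memLp_liftIoc.haarAddCircle
  have h := (fourierBasis (T := 1 - 0)).hasSum_inner_mul_inner hF.toLp hG.toLp
  have hval : ∫ t in (0 : ℝ)..1, conj (f t) * g t = inner ℂ hF.toLp hG.toLp := by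
    rw [L2.inner_def]
    have h1 : ∫ t in (0 : ℝ)..1, conj (f t) * g t =
        ∫ x, AddCircle.liftIoc (1 - 0) 0 (fun t => conj (f t) * g t) x
          ∂(AddCircle.haarAddCircle (T := 1 - 0)) := by
      rw [AddCircle.integral_haarAddCircle, AddCircle.integral_liftIoc_eq_intervalIntegral]
      simp
    rw [h1]
    refine integral_congr_ae ?_
    filter_upwards [hF.coeFn_toLp, hG.coeFn_toLp] with x hx hy
    rw [hx, hy, RCLike.inner_apply, mul_comm]
    rfl
  rw [hval]
  refine h.congr_fun fun k => ?_
  rw [← inner_conj_symm, ← HilbertBasis.repr_apply_apply, ← HilbertBasis.repr_apply_apply,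
    fourierBasis_repr, fourierBasis_repr, fourierCoeff_congr_ae hF.coeFn_toLp,
    fourierCoeff_congr_ae hG.coeFn_toLp]
  rfl

lemma fourierCoeffOn_unitInterval (f : ℝ → ℂ) (k : ℤ) :
    fourierCoeffOn zero_lt_one f k =
      ∫ t in (0 : ℝ)..1, Complex.exp (-(2 * Real.pi * k * Complex.I) * t) * f t := by
  have h : ∀ t : ℝ, fourier (-k) (t : AddCircle (1 - 0 : ℝ)) • f t =
      Complex.exp (-(2 * Real.pi * k * Complex.I) * t) * f t := fun t => by
    rw [fourier_coe_apply, smul_eq_mul, sub_zero, Complex.ofReal_one, div_one]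
    congr 2
    push_cast
    ring
  rw [fourierCoeffOn_eq_integral]
  simp_rw [h]
  simp

lemma memLp_exp (a : ℝ) :
    MemLp (fun t : ℝ => (Real.exp (-a * t) : ℂ)) 2 (volume.restrict (Ioc 0 1)) := by
  have hc : Continuous fun t : ℝ => (Real.exp (-a * t) : ℂ) := by fun_prop
  obtain ⟨C, hC⟩ := isCompact_Icc.exists_bound_of_continuousOn (s := Icc (0 : ℝ) 1) hc.continuousOn
  refine MemLp.of_bound hc.aestronglyMeasurable C ?_
  filter_upwards [ae_restrict_mem measurableSet_Ioc] with t ht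
  exact hC t (Ioc_subset_Icc_self ht)

lemma fourierCoeffOn_exp {a : ℝ} (ha : a ≠ 0) (k : ℤ) :
    fourierCoeffOn zero_lt_one (fun t : ℝ => (Real.exp (-a * t) : ℂ)) k =
      (1 - Real.exp (-a) : ℝ) / (a + 2 * Real.pi * k * Complex.I) := by
  have hne : (a + 2 * Real.pi * k * Complex.I : ℂ) ≠ 0 := fun h => ha (by
    simpa using congrArg Complex.re h)
  rw [fourierCoeffOn_unitInterval]
  have h : ∀ t : ℝ, Complex.exp (-(2 * Real.pi * k * Complex.I) * t) * (Real.exp (-a * t) : ℂ) =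
      Complex.exp (-(a + 2 * Real.pi * k * Complex.I) * t) := fun t => by
    rw [Complex.ofReal_exp, ← Complex.exp_add]
    push_cast
    ring_nf
  simp_rw [h]
  have h1 : Complex.exp (-(a + 2 * Real.pi * k * Complex.I)) = Real.exp (-a) := by
    rw [neg_add, Complex.exp_add, Complex.exp_neg (2 * Real.pi * k * Complex.I)]
    have : Complex.exp (2 * Real.pi * k * Complex.I) = 1 := by
      rw [← Complex.exp_int_mul_two_pi_mul_I k]
      ring_nf
    rw [this]
    simp
  rw [integral_exp_mul_complex (neg_ne_zero.2 hne)]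
  simp only [Complex.ofReal_one, mul_one, Complex.ofReal_zero, mul_zero, Complex.exp_zero, h1]
  push_cast
  rw [div_neg, ← neg_div, neg_sub]

lemma fourierCoeffOn_log_Gamma_zero :
    fourierCoeffOn zero_lt_one (fun t : ℝ => (Real.log (Real.Gamma t) : ℂ)) 0 =
      (Real.log (2 * Real.pi) / 2 : ℝ) := by
  rw [fourierCoeffOn_unitInterval, ← integral_log_Gamma_unitInterval,
    ← intervalIntegral.integral_ofReal]
  simp

lemma fourierCoeffOn_log_Gamma {k : ℤ} (hk : k ≠ 0) :
    fourierCoeffOn zero_lt_one (fun t : ℝ => (Real.log (Real.Gamma t) : ℂ)) k =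
      (Real.eulerMascheroniConstant + Complex.log (2 * Real.pi * k * Complex.I)) /
        (2 * Real.pi * k * Complex.I) := by
  rw [fourierCoeffOn_unitInterval]
  refine integral_cexp_mul_log_Gamma ?_ (Or.inr ?_)
  · rw [← Complex.exp_int_mul_two_pi_mul_I k]
    ring_nf
  · have : (2 * Real.pi * k * Complex.I).im = 2 * Real.pi * k := by
      simp [Complex.mul_im]
    rw [this]
    have : (k : ℝ) ≠ 0 := Int.cast_ne_zero.2 hk
    have := Real.pi_ne_zero
    positivity

/-- Parseval terms of index `±k`, with `b = 2πk`, `g = γ + ln b` and `s = π/2` the argument of `i`.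
-/
lemma conj_mul_add_conj_mul_eq {a b : ℝ} (hb : b ≠ 0) (c g s : ℝ) :
    conj (c / (a + b * Complex.I) : ℂ) * ((g + s * Complex.I) / (b * Complex.I)) +
      conj (c / (a + b * -Complex.I) : ℂ) * ((g + -s * Complex.I) / (b * -Complex.I)) =
      ((c * (2 * g / (a ^ 2 + b ^ 2) + 2 * s * a / (b * (a ^ 2 + b ^ 2))) : ℝ) : ℂ) := by
  have hb' : (b : ℂ) ≠ 0 := Complex.ofReal_ne_zero.2 hb
  have hp : (a + b * Complex.I : ℂ) ≠ 0 := fun h => hb (by simpa using congrArg Complex.im h)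
  have hq : (a - b * Complex.I : ℂ) ≠ 0 := fun h => hb (by simpa using congrArg Complex.im h)
  have hI := Complex.I_ne_zero
  have hpq : (a ^ 2 + b ^ 2 : ℂ) = (a + b * Complex.I) * (a - b * Complex.I) := by
    linear_combination (b : ℂ) ^ 2 * Complex.I_sq
  have h1 : conj (c / (a + b * Complex.I) : ℂ) = c / (a - b * Complex.I) := by
    simp [sub_eq_add_neg]
  have h2 : conj (c / (a + b * -Complex.I) : ℂ) = c / (a + b * Complex.I) := by
    simp
  push_cast
  rw [hpq, h1, h2]
  field_simp
  ring_nf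

/-- Parseval's identity for `e^{-at}` and `ln Γ(t)`, with the terms of index `±k` combined. -/
lemma hasSum_integral_exp_mul_log_Gamma {a : ℝ} (ha : 0 < a) :
    HasSum (fun j : ℕ => (1 - Real.exp (-a)) *
      (2 * (Real.eulerMascheroniConstant + Real.log (2 * Real.pi * (j + 1))) /
        (a ^ 2 + 4 * Real.pi ^ 2 * (j + 1) ^ 2) +
        a / (2 * (j + 1) * (a ^ 2 + 4 * Real.pi ^ 2 * (j + 1) ^ 2))))
      ((∫ t in (0 : ℝ)..1, Real.exp (-a * t) * Real.log (Real.Gamma t)) -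
        (1 - Real.exp (-a)) / a * (Real.log (2 * Real.pi) / 2)) := by
  have h := hasSum_conj_fourierCoeffOn_mul (memLp_exp a) memLp_log_Gamma.ofReal
  have hval : ∫ t in (0 : ℝ)..1, conj (Real.exp (-a * t) : ℂ) * (Real.log (Real.Gamma t) : ℂ) =
      (∫ t in (0 : ℝ)..1, Real.exp (-a * t) * Real.log (Real.Gamma t) : ℝ) := by
    rw [← intervalIntegral.integral_ofReal]
    simp only [Complex.conj_ofReal, Complex.ofReal_mul]
  -- Pairing `k` with `-k` counts index `0` twice; dropping the first pair removes it altogether.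
  have h2 := (hasSum_nat_add_iff' 1).2 h.nat_add_neg
  simp only [RCLike.ofReal_eq_complex_ofReal, Finset.sum_range_one, Nat.cast_zero, neg_zero,
    hval, fourierCoeffOn_exp ha.ne', fourierCoeffOn_log_Gamma_zero] at h2
  rw [← Complex.hasSum_ofReal]
  convert! h2 using 1
  · funext j
    have hj : ((j + 1 : ℕ) : ℤ) ≠ 0 := by positivity
    have hj' : -((j + 1 : ℕ) : ℤ) ≠ 0 := neg_ne_zero.2 hj
    have hpos : 0 < 2 * Real.pi * ((j : ℝ) + 1) := by positivity
    have e1 : (2 * Real.pi * (((j + 1 : ℕ) : ℤ) : ℂ) * Complex.I : ℂ) =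
        ((2 * Real.pi * ((j : ℝ) + 1) : ℝ) : ℂ) * Complex.I := by push_cast; ring
    have e2 : (2 * Real.pi * ((-((j + 1 : ℕ) : ℤ) : ℤ) : ℂ) * Complex.I : ℂ) =
        ((2 * Real.pi * ((j : ℝ) + 1) : ℝ) : ℂ) * -Complex.I := by push_cast; ring
    rw [fourierCoeffOn_log_Gamma hj, fourierCoeffOn_log_Gamma hj', e1, e2,
      Complex.log_ofReal_mul hpos Complex.I_ne_zero,
      Complex.log_ofReal_mul hpos (neg_ne_zero.2 Complex.I_ne_zero), Complex.log_I,
      Complex.log_neg_I]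
    have e3 := conj_mul_add_conj_mul_eq (a := a) hpos.ne' (1 - Real.exp (-a))
      (Real.eulerMascheroniConstant + Real.log (2 * Real.pi * (j + 1))) (Real.pi / 2)
    have e4 : a ^ 2 + 4 * Real.pi ^ 2 * ((j : ℝ) + 1) ^ 2 =
      a ^ 2 + (2 * Real.pi * ((j : ℝ) + 1)) ^ 2 := by ring
    have e5 : a / (2 * ((j : ℝ) + 1) * (a ^ 2 + 4 * Real.pi ^ 2 * ((j : ℝ) + 1) ^ 2)) =
        2 * (Real.pi / 2) * a /
          ((2 * Real.pi * ((j : ℝ) + 1)) * (a ^ 2 + (2 * Real.pi * ((j : ℝ) + 1)) ^ 2)) := by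
      rw [e4]
      have := Real.pi_pos
      field_simp
    rw [e5, e4, ← e3]
    push_cast
    ring
  · simp [← Complex.exp_conj]

/-- Parseval's identity for `e^{-at}`. -/
lemma hasSum_inv_sq_add_sq {a : ℝ} (ha : 0 < a) :
    HasSum (fun j : ℕ => 1 / (a ^ 2 + 4 * Real.pi ^ 2 * ((j : ℝ) + 1) ^ 2))
      ((2 - (1 - Real.exp (-a))) / (4 * a * (1 - Real.exp (-a))) - 1 / (2 * a ^ 2)) := by
  have hc : 0 < 1 - Real.exp (-a) := by simpa using ha
  have h := hasSum_sq_fourierCoeffOn zero_lt_one (memLp_exp a)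
  have hterm : ∀ k : ℤ, ‖fourierCoeffOn zero_lt_one (fun t : ℝ => (Real.exp (-a * t) : ℂ)) k‖ ^ 2 =
      (1 - Real.exp (-a)) ^ 2 * (1 / (a ^ 2 + 4 * Real.pi ^ 2 * (k : ℝ) ^ 2)) := fun k => by
    have : (a + 2 * Real.pi * k * Complex.I : ℂ) =
        (a : ℂ) + ((2 * Real.pi * k : ℝ) : ℂ) * Complex.I := by push_cast; ring
    rw [fourierCoeffOn_exp ha.ne', norm_div, div_pow, Complex.norm_real, Real.norm_eq_abs, sq_abs,
      this, Complex.sq_norm, Complex.normSq_add_mul_I]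
    ring
  -- With `c = 1 - e^{-a}`, the numerator `1 - e^{-2a}` factors as `c(2 - c)`.
  have hint : ∫ t in (0 : ℝ)..1, ‖(Real.exp (-a * t) : ℂ)‖ ^ 2 =
      (1 - Real.exp (-a)) * (2 - (1 - Real.exp (-a))) / (2 * a) := by
    have h1 : ∀ t : ℝ, ‖(Real.exp (-a * t) : ℂ)‖ ^ 2 = Real.exp (-(2 * a) * t) := fun t => by
      rw [Complex.norm_real, Real.norm_of_nonneg (Real.exp_pos _).le, ← Real.exp_nat_mul]
      push_cast
      ring_nf
    have h2 : Real.exp (-(2 * a)) = Real.exp (-a) ^ 2 := by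
      rw [← Real.exp_nat_mul]
      push_cast
      ring_nf
    simp_rw [h1]
    rw [intervalIntegral.integral_comp_mul_left (fun x => Real.exp x) (by simpa using ha.ne'),
      integral_exp]
    simp only [mul_one, mul_zero, Real.exp_zero, h2, smul_eq_mul]
    field_simp
    ring
  simp only [hterm, hint] at h
  have h2 := ((hasSum_nat_add_iff' 1).2 h.nat_add_neg).div_const (2 * (1 - Real.exp (-a)) ^ 2)
  convert! h2 using 1
  · funext j
    push_cast
    field_simp
    ring
  · simp
    field_simp
    ring

end Parseval

/-! ### Series for `Λ` and assembly -/

section LambdaFunction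

lemma summable_sq_div_mul_sq_add_sq (z : ℝ) :
    Summable fun j : ℕ => z ^ 2 / (((j : ℝ) + 1) * (((j : ℝ) + 1) ^ 2 + z ^ 2)) := by
  have h : Summable fun j : ℕ => z ^ 2 * (1 / ((j + 1 : ℕ) : ℝ) ^ 2) :=
    ((summable_nat_add_iff 1).2 (Real.summable_one_div_nat_pow.2 one_lt_two)).mul_left _
  refine h.of_nonneg_of_le (fun j => by positivity) fun j => ?_
  push_cast
  rw [mul_one_div]
  have hj : (0 : ℝ) ≤ j := j.cast_nonneg
  refine div_le_div_of_nonneg_left (sq_nonneg z) (by positivity) ?_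
  nlinarith [sq_nonneg z, sq_nonneg ((j : ℝ) + 1), mul_nonneg hj (sq_nonneg ((j : ℝ) + 1)),
    mul_nonneg hj (sq_nonneg z)]

/-- Split `j/(j² + z²) = 1/j - z²/(j(j² + z²))`: the harmonic part minus `ln n` tends to `γ`, the
rest converges. -/
lemma tendsto_LambdaSeq (z : ℝ) :
    Tendsto (LambdaSeq z) atTop (𝓝 (Real.eulerMascheroniConstant -
      ∑' j : ℕ, z ^ 2 / (((j : ℝ) + 1) * (((j : ℝ) + 1) ^ 2 + z ^ 2)))) := by
  refine (Real.tendsto_harmonic_sub_log.sub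
    (summable_sq_div_mul_sq_add_sq z).hasSum.tendsto_sum_nat).congr fun n => ?_
  have h : ∀ j : ℕ, ((j : ℝ) + 1) / (((j : ℝ) + 1) ^ 2 + z ^ 2) =
      ((j : ℝ) + 1)⁻¹ - z ^ 2 / (((j : ℝ) + 1) * (((j : ℝ) + 1) ^ 2 + z ^ 2)) := fun j => by
    have h1 : (j : ℝ) + 1 ≠ 0 := by positivity
    have h2 : ((j : ℝ) + 1) ^ 2 + z ^ 2 ≠ 0 := by positivity
    field_simp
    ring
  have hs : ∑ j ∈ Finset.Icc 1 n, (j : ℝ) / ((j : ℝ) ^ 2 + z ^ 2) =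
      ∑ j ∈ Finset.range n, ((j : ℝ) + 1) / (((j : ℝ) + 1) ^ 2 + z ^ 2) := by
    have h1 := Finset.sum_Ico_add' (fun j : ℕ => (j : ℝ) / ((j : ℝ) ^ 2 + z ^ 2)) 0 n 1
    push_cast at h1
    rw [Finset.range_eq_Ico, h1]
    rfl
  rw [LambdaSeq, hs, Finset.sum_congr rfl fun j _ => h j, Finset.sum_sub_distrib, harmonic]
  push_cast
  ring

lemma Lambda_eq (z : ℝ) :
    Lambda z = Real.eulerMascheroniConstant -
      ∑' j : ℕ, z ^ 2 / (((j : ℝ) + 1) * (((j : ℝ) + 1) ^ 2 + z ^ 2)) :=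
  (tendsto_LambdaSeq z).limUnder_eq

lemma hasSum_Lambda {a : ℝ} :
    HasSum (fun j : ℕ => a ^ 2 / (((j : ℝ) + 1) * (a ^ 2 + 4 * Real.pi ^ 2 * ((j : ℝ) + 1) ^ 2)))
      (Real.eulerMascheroniConstant - Lambda (a / (2 * Real.pi))) := by
  rw [Lambda_eq, sub_sub_cancel]
  refine (summable_sq_div_mul_sq_add_sq _).hasSum.congr_fun fun j => ?_
  have := Real.pi_pos
  have h1 : (j : ℝ) + 1 ≠ 0 := by positivity
  have h2 : a ^ 2 + 4 * Real.pi ^ 2 * ((j : ℝ) + 1) ^ 2 ≠ 0 := by positivity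
  have h3 : ((j : ℝ) + 1) ^ 2 + (a / (2 * Real.pi)) ^ 2 =
      (a ^ 2 + 4 * Real.pi ^ 2 * ((j : ℝ) + 1) ^ 2) / (2 * Real.pi) ^ 2 := by
    field_simp
    ring
  rw [h3]
  field_simp

/-- Parseval's series divided by `2c`, with `ln(2πj) = ln(2π) + ln j`, minus the two series already
summed. This gives summability along with the value. -/
lemma hasSum_log_div {a : ℝ} (ha : 0 < a) :
    HasSum (fun j : ℕ =>
      Real.log ((j : ℝ) + 1) / (a ^ 2 + 4 * Real.pi ^ 2 * ((j : ℝ) + 1) ^ 2))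
      (((∫ t in (0 : ℝ)..1, Real.exp (-a * t) * Real.log (Real.Gamma t)) -
        (1 - Real.exp (-a)) / a * (Real.log (2 * Real.pi) / 2)) / (2 * (1 - Real.exp (-a))) -
        (Real.log (2 * Real.pi) + Real.eulerMascheroniConstant) *
          ((2 - (1 - Real.exp (-a))) / (4 * a * (1 - Real.exp (-a))) - 1 / (2 * a ^ 2)) -
        (Real.eulerMascheroniConstant - Lambda (a / (2 * Real.pi))) / (4 * a)) := by
  have hc : 0 < 1 - Real.exp (-a) := by simpa using ha
  refine ((((hasSum_integral_exp_mul_log_Gamma ha).div_const (2 * (1 - Real.exp (-a)))).sub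
    ((hasSum_inv_sq_add_sq ha).mul_left
      (Real.log (2 * Real.pi) + Real.eulerMascheroniConstant))).sub
    (hasSum_Lambda.div_const (4 * a))).congr_fun fun j => ?_
  have := Real.pi_pos
  have h1 : (j : ℝ) + 1 ≠ 0 := by positivity
  have h2 : a ^ 2 + 4 * Real.pi ^ 2 * ((j : ℝ) + 1) ^ 2 ≠ 0 := by positivity
  rw [Real.log_mul (by positivity) h1]
  generalize a ^ 2 + 4 * Real.pi ^ 2 * ((j : ℝ) + 1) ^ 2 = d at *
  generalize 1 - Real.exp (-a) = c at *
  field_simp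
  ring

end LambdaFunction

theorem mainTheorem5 (a c A : ℝ) (ha : 0 < a) (hc : c = 1 - Real.exp (-a))
    (hA : A = Real.log (2 * Real.pi) + Real.eulerMascheroniConstant) :
    (∀ z : ℝ, Tendsto (LambdaSeq z) atTop (𝓝 (Lambda z))) ∧
    Lambda 0 = Real.eulerMascheroniConstant ∧
    IntervalIntegrable (fun t : ℝ => Real.exp (-a * t) * Real.log (Real.Gamma t))
      MeasureTheory.volume 0 1 ∧
    Summable (fun j : ℕ =>
      Real.log ((j : ℝ) + 1) / (a ^ 2 + 4 * Real.pi ^ 2 * ((j : ℝ) + 1) ^ 2)) ∧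
    ∫ t in (0 : ℝ)..1, Real.exp (-a * t) * Real.log (Real.Gamma t) =
      A * (a - c) / a ^ 2 - c / (2 * a) * Lambda (a / (2 * Real.pi)) +
        2 * c * ∑' j : ℕ,
          Real.log ((j : ℝ) + 1) / (a ^ 2 + 4 * Real.pi ^ 2 * ((j : ℝ) + 1) ^ 2) := by
  refine ⟨fun z => ?_, ?_, intervalIntegrable_log_Gamma.continuousOn_mul (by fun_prop),
    (hasSum_log_div ha).summable, ?_⟩
  · rw [Lambda_eq]
    exact tendsto_LambdaSeq z
  · rw [Lambda_eq]
    simp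
  · have hc0 : c ≠ 0 := by
      have : 0 < 1 - Real.exp (-a) := by simpa using ha
      exact hc ▸ this.ne'
    rw [(hasSum_log_div ha).tsum_eq, ← hc, hA]
    field_simp
    ring
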